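/- Let $X$ be a nonzero Banach space over $\mathbb K\in\{\mathbb R,\mathbb C\}$ which is a Daugavet space, i.e. $\|\mathrm{Id}+T\|=1+\|T\|$ for every bounded linear operator $T:X\to X$ of rank one. Let $Z$ be a Banach space over $\mathbb K$ that is an unconditional sum of a (finite, countable or arbitrary) family of Banach spaces $(E_i)_{i\in I}$: there are isomorphic embeddings $j_i:E_i\to Z$ such that every $z\in Z$ has a unique expansion $z=\sum_{i\in I}j_i(x_i)$ with $x_i\in E_i$, the series converging unconditionally in norm. If no $E_i$ contains an isomorphic copy of $\ell_1$, then $X$ is not isomorphic to a subspace of $Z$. -/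

import Mathlib

/-- `X` is a Daugavet space: every bounded linear operator `T : X → X` of rank one satisfies
the Daugavet equation `‖Id + T‖ = 1 + ‖T‖`. -/
def IsDaugavetSpace (𝕜 X : Type*) [RCLike 𝕜] [NormedAddCommGroup X] [NormedSpace 𝕜 X] : Prop :=
  ∀ T : X →L[𝕜] X, (T : X →ₗ[𝕜] X).rank = 1 → ‖ContinuousLinearMap.id 𝕜 X + T‖ = 1 + ‖T‖

/-- `X` embeds isomorphically into `Y`: some bounded linear operator `X → Y` is a homeomorphism
onto its image. -/
def EmbedsIsomorphically (𝕜 X Y : Type*) [RCLike 𝕜] [NormedAddCommGroup X] [NormedSpace 𝕜 X]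
    [NormedAddCommGroup Y] [NormedSpace 𝕜 Y] : Prop :=
  ∃ T : X →L[𝕜] Y, Topology.IsEmbedding T

/-- `X` contains an isomorphic copy of the sequence space `ℓ₁` (over the scalar field `𝕜`). -/
def ContainsEllOne (𝕜 X : Type*) [RCLike 𝕜] [NormedAddCommGroup X] [NormedSpace 𝕜 X] : Prop :=
  EmbedsIsomorphically 𝕜 (lp (fun _ : ℕ => 𝕜) 1) X

/-- `Z` is an unconditional sum of the spaces `E i`, which sit in `Z` through the isomorphic
embeddings `j i`: every `z` in `Z` has exactly one expansion `z = ∑ i, j i (x i)` with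
`x i ∈ E i`, where the series converges unconditionally, that is, along the net of finite subsets
of the index set. -/
structure IsUnconditionalSum {𝕜 ι Z : Type*} {E : ι → Type*} [RCLike 𝕜]
    [NormedAddCommGroup Z] [NormedSpace 𝕜 Z]
    [∀ i, NormedAddCommGroup (E i)] [∀ i, NormedSpace 𝕜 (E i)]
    (j : ∀ i, E i →L[𝕜] Z) : Prop where
  isEmbedding : ∀ i, Topology.IsEmbedding (j i)
  existsUnique_hasSum : ∀ z : Z, ∃! x : ∀ i, E i, HasSum (fun i => j i (x i)) z

/-!
A Daugavet space `X` is rich in `ℓ₁`-structure: an element `z` of the unit ball is *generic* if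
`‖w + z‖` is almost `‖w‖ + 1` for the vectors `w` under consideration, and every slice of the ball
contains generic elements. The weak cluster points of generic elements form a closed convex set,
because convex combinations of successively generic elements are generic; hence the whole ball is
in the weak closure of the generic elements (`IsDaugavetSpace.mapClusterPt_generic`).

If `T : X → E` is an operator and `E` has no copy of `ℓ₁`, then weak approximation can be improved
to norm approximation: for `y` in the ball there is a generic `z` with `T z` close to `T y`. Take an
ultrafilter of generic points that converges weakly to `y`. Consider the game in which elements
`z₁, z₂, …` are picked from sets of the ultrafilter, one after the other, until a convex
combination of the vectors `T (z_i - y)` is small in norm. By the Hahn–Banach theorem a play that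
fails so far leaves a functional in the dual ball that is bounded below on all `T (z_i - y)`, so the
game is recorded by the shrinking compact sets of such functionals, and success is the notion
`Exhausted`. If there is no winning strategy, then compactness allows one to insert, at any stage, a
new element on which the functionals are small, and the resulting tree of patterns produces an
independent sequence, which spans `ℓ₁` in `E` (`exists_independent_seq`,
`exhausted_of_not_containsEllOne`). As the convex combination is taken of successively generic
elements, it is generic, and the procedure can be repeated for finitely many operators
(`IsDaugavetSpace.exists_generic_near`).

Suppose now that `J : X → Z` is an isomorphic embedding. The partial sums `S_B` over finite sets `B`
of indices are uniformly bounded (`IsUnconditionalSum.exists_projections`). Choose generic elements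
`z₁, z₂, …` of the ball and finite sets `A₁ ⊆ A₂ ⊆ ⋯` with `S_{A_k} J z_k ≈ J z_k` and
`S_B J z_{k+1} ≈ S_B J z_k` for `B ⊆ A_k`. Then the block `S_{A_k \ A_{k-1}} J z_n` is close to
`J (z_k - z_{k-1})` for all `n ≥ k`, so the sum of every other increment,
`v = (z₂ - z₁) + (z₄ - z₃) + ⋯`, satisfies `J v ≈ S_B J z_n` for a suitable `B` and stays bounded.
But `‖v‖` grows linearly with the number of terms, because the `z_k` are generic.
-/

open Filter Topology Set

/-! ### Exhaustion along a filter -/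

/-- Fix a filter `F` on `α` and sets `A z ⊆ K` indexed by `z : α`. A set `Q ⊆ K` is *exhausted* if
a player who, round after round, announces a set of `F`, receives an element `z` of it and cuts
`Q` down to `Q ∩ A z`, has a strategy that leads to the empty set after finitely many rounds.
The number of rounds need not be bounded in advance. -/
inductive Exhausted {α K : Type*} (F : Filter α) (A : α → Set K) : Set K → Prop
  | empty : Exhausted F A ∅
  | step (Q : Set K) (U : Set α) (hU : U ∈ F) (h : ∀ z ∈ U, Exhausted F A (Q ∩ A z)) :
      Exhausted F A Q

namespace Exhausted

variable {α K : Type*} {F : Filter α} {A A₁ A₂ : α → Set K} {Q Q₁ Q₂ : Set K}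

theorem of_eventually (h : ∀ᶠ z in F, Exhausted F A (Q ∩ A z)) : Exhausted F A Q :=
  step Q _ h fun _ hz => hz

theorem mono (h : Exhausted F A₂ Q₂) (hA : ∀ z, A₁ z ⊆ A₂ z) (hQ : Q₁ ⊆ Q₂) :
    Exhausted F A₁ Q₁ := by
  induction h generalizing Q₁ with
  | empty => rw [subset_empty_iff.1 hQ]; exact empty
  | step Q U hU _ ih => exact step _ U hU fun z hz => ih z hz (inter_subset_inter hQ (hA z))

theorem union (h₁ : Exhausted F A Q₁) (h₂ : Exhausted F A Q₂) : Exhausted F A (Q₁ ∪ Q₂) := by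
  induction h₁ generalizing Q₂ with
  | empty => simpa using h₂
  | step Q U hU _ ih =>
    refine step _ U hU fun z hz => ?_
    rw [union_inter_distrib_right]
    exact ih z hz (h₂.mono (fun _ => Subset.rfl) inter_subset_left)

/-- The strategies for `A₁` and `A₂` are played side by side: each round makes progress in the
first one on the part cut by `A₁ z`, and in the second one on the part cut by `A₂ z`. -/
theorem inter_of_subset_union (hA : ∀ z, A z ⊆ A₁ z ∪ A₂ z)
    (h₁ : Exhausted F A₁ Q₁) (h₂ : Exhausted F A₂ Q₂) : Exhausted F A (Q₁ ∩ Q₂) := by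
  induction h₁ generalizing Q₂ with
  | empty => rw [empty_inter]; exact empty
  | step Q U hU _ ih =>
    induction h₂ with
    | empty => rw [inter_empty]; exact empty
    | step Q' U' hU' h₂' ih' =>
      refine step _ (U ∩ U') (inter_mem hU hU') fun z hz => ?_
      refine ((ih z hz.1 (step Q' U' hU' h₂')).union (ih' z hz.2)).mono (fun _ => Subset.rfl) ?_
      rintro k ⟨⟨hk, hk'⟩, hkA⟩
      rcases hA z hkA with h | h
      · exact Or.inl ⟨⟨hk, h⟩, hk'⟩
      · exact Or.inr ⟨hk, hk', h⟩

/-- If the sets `A z = {k | f z k ∈ C}` do not exhaust `K`, then neither do the sets of those `k`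
with `f z k` close to one suitable point of `C`. -/
theorem exists_point_not_exhausted {V : Type*} [TopologicalSpace V] {f : α → K → V} {C : Set V}
    (hC : IsCompact C) (h : ¬ Exhausted F (fun z => {k | f z k ∈ C}) univ) :
    ∃ c ∈ C, ∀ t ∈ 𝓝 c, ¬ Exhausted F (fun z => {k | f z k ∈ t}) univ := by
  by_contra! hc
  refine h (hC.induction_on (p := fun S => Exhausted F (fun z => {k | f z k ∈ S}) univ)
    ?_ ?_ ?_ ?_)
  · refine of_eventually (Eventually.of_forall fun z => ?_)
    simpa using empty
  · exact fun s t hst ht => ht.mono (fun z k hk => hst hk) Subset.rfl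
  · intro s t hs ht
    rw [← univ_inter (univ : Set K)]
    exact inter_of_subset_union (fun z k hk => hk) hs ht
  · intro c hcC
    obtain ⟨t, ht, h⟩ := hc c hcC
    exact ⟨t, mem_nhdsWithin_of_mem_nhds ht, h⟩

variable {𝒰 : Ultrafilter α}

theorem not_inter_of_ultrafilter (h : ¬ Exhausted 𝒰 A Q) :
    ∀ᶠ z in 𝒰, ¬ Exhausted 𝒰 A (Q ∩ A z) := by
  rw [Ultrafilter.eventually_not]
  exact fun h' => h (of_eventually h')

/-- Compactness is what makes it possible to ask for a small value of `f z`: if that lost the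
non-exhaustion for most `z`, finitely many of the open sets `{k | ‖f z k‖ < η}` would cover `Q`. -/
theorem not_inter_small [TopologicalSpace K] {V : Type*} [SeminormedAddCommGroup V]
    {f : α → K → V}
    (hf : ∀ z, Continuous (f z)) (hlim : ∀ k, Tendsto (fun z => f z k) 𝒰 (𝓝 0))
    (hQ : IsCompact Q) (h : ¬ Exhausted 𝒰 A Q) {η : ℝ} (hη : 0 < η) :
    ∀ᶠ z in 𝒰, ¬ Exhausted 𝒰 A (Q ∩ {k | ‖f z k‖ ≤ η}) := by
  rw [Ultrafilter.eventually_not]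
  intro h'
  refine h (hQ.induction_on empty (fun s t hst ht => ht.mono (fun _ => Subset.rfl) hst)
    (fun s t => union) fun k hk => ?_)
  have hk' : ∀ᶠ z in 𝒰, ‖f z k‖ < η := by
    have := (hlim k).norm
    rw [norm_zero] at this
    exact this.eventually_lt_const hη
  obtain ⟨z, hz, hzk⟩ := (h'.and hk').exists
  refine ⟨_, inter_mem self_mem_nhdsWithin (mem_nhdsWithin_of_mem_nhds ?_), hz⟩
  have : {k | ‖f z k‖ < η} ∈ 𝓝 k :=
    (isOpen_lt (hf z).norm continuous_const).mem_nhds hzk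
  exact mem_of_superset this fun k' (hk' : ‖f z k'‖ < η) => hk'.le

end Exhausted

/-- If the sets `{k | ‖f z k - c‖ ≤ η}` do not exhaust `K`, then the family `f` contains an
independent sequence: at a suitable point `k` its values are, up to `η`, equal to `c` at any
prescribed set of indices and to `0` at the other ones. -/
theorem exists_independent_seq {α K V : Type*} [TopologicalSpace K] [CompactSpace K]
    [SeminormedAddCommGroup V] {𝒰 : Ultrafilter α} {f : α → K → V}
    (hf : ∀ z, Continuous (f z)) (hlim : ∀ k, Tendsto (fun z => f z k) 𝒰 (𝓝 0))
    {c : V} {η : ℝ} (hη : 0 < η)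
    (h : ¬ Exhausted 𝒰 (fun z => {k | f z k ∈ Metric.closedBall c η}) univ)
    {p : α → Prop} (hp : ∀ᶠ z in 𝒰, p z) :
    ∃ u : ℕ → α, (∀ n, p (u n)) ∧ ∀ (P : ℕ → Prop) (n : ℕ), ∃ k, ∀ i < n,
      (P i → ‖f (u i) k - c‖ ≤ η) ∧ (¬ P i → ‖f (u i) k‖ ≤ η) := by
  classical
  set A : α → Set K := fun z => {k | f z k ∈ Metric.closedBall c η}
  set B : α → Set K := fun z => {k | ‖f z k‖ ≤ η}
  have hAc : ∀ z, IsClosed (A z) := fun z => Metric.isClosed_closedBall.preimage (hf z)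
  have hBc : ∀ z, IsClosed (B z) := fun z => isClosed_le (hf z).norm continuous_const
  -- A stage of the construction is a finite family of closed sets that are not exhausted: the
  -- sets cut out by all the sign patterns on the terms chosen so far.
  let Stage := {S : Set (Set K) // S.Finite ∧ ∀ Q ∈ S, IsClosed Q ∧ ¬ Exhausted 𝒰 A Q}
  have step : ∀ S : Stage, ∃ z, p z ∧
      ∀ Q ∈ S.1, ¬ Exhausted 𝒰 A (Q ∩ A z) ∧ ¬ Exhausted 𝒰 A (Q ∩ B z) := by
    intro S
    have : ∀ᶠ z in (𝒰 : Filter α),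
        ∀ Q ∈ S.1, ¬ Exhausted 𝒰 A (Q ∩ A z) ∧ ¬ Exhausted 𝒰 A (Q ∩ B z) :=
      (eventually_all_finite S.2.1).2 fun Q hQ =>
        (Exhausted.not_inter_of_ultrafilter (S.2.2 Q hQ).2).and
          (Exhausted.not_inter_small hf hlim (S.2.2 Q hQ).1.isCompact (S.2.2 Q hQ).2 hη)
    exact (hp.and this).exists
  choose z hpz hz using step
  let next : Stage → Stage := fun S =>
    ⟨(fun Q => Q ∩ A (z S)) '' S.1 ∪ (fun Q => Q ∩ B (z S)) '' S.1,
      (S.2.1.image _).union (S.2.1.image _), by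
        rintro _ (⟨Q, hQ, rfl⟩ | ⟨Q, hQ, rfl⟩)
        · exact ⟨(S.2.2 Q hQ).1.inter (hAc _), (hz S Q hQ).1⟩
        · exact ⟨(S.2.2 Q hQ).1.inter (hBc _), (hz S Q hQ).2⟩⟩
  let S₀ : Stage := ⟨{univ}, finite_singleton _, by rintro Q rfl; exact ⟨isClosed_univ, h⟩⟩
  let S : ℕ → Stage := fun n => Nat.rec S₀ (fun _ => next) n
  refine ⟨fun n => z (S n), fun n => hpz _, fun P n => ?_⟩
  have key : ∃ Q ∈ (S n).1, ∀ k ∈ Q, ∀ i < n,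
      (P i → ‖f (z (S i)) k - c‖ ≤ η) ∧ (¬ P i → ‖f (z (S i)) k‖ ≤ η) := by
    induction n with
    | zero => exact ⟨univ, rfl, by simp⟩
    | succ n ih =>
      obtain ⟨Q, hQ, hk⟩ := ih
      by_cases hP : P n
      · refine ⟨Q ∩ A (z (S n)), Or.inl ⟨Q, hQ, rfl⟩, fun k hkQ i hi => ?_⟩
        rcases Nat.lt_succ_iff_lt_or_eq.1 hi with hi | rfl
        · exact hk k hkQ.1 i hi
        · exact ⟨fun _ => mem_closedBall_iff_norm.1 hkQ.2, fun h => absurd hP h⟩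
      · refine ⟨Q ∩ B (z (S n)), Or.inr ⟨Q, hQ, rfl⟩, fun k hkQ i hi => ?_⟩
        rcases Nat.lt_succ_iff_lt_or_eq.1 hi with hi | rfl
        · exact hk k hkQ.1 i hi
        · exact ⟨fun h => absurd h hP, fun _ => hkQ.2⟩
  obtain ⟨Q, hQ, hk⟩ := key
  have hne : Q.Nonempty := by
    rw [nonempty_iff_ne_empty]
    rintro rfl
    exact ((S n).2.2 ∅ hQ).2 Exhausted.empty
  exact ⟨hne.some, hk _ hne.some_mem⟩

/-! ### Sequences equivalent to the unit vector basis of `ℓ₁` -/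

/-- A finite family of scalars has a subfamily whose sum is at least a quarter of the sum of the
moduli: one of the four subfamilies on which the real or imaginary part has constant sign. -/
theorem exists_subset_sum_norm_le {𝕜 ι : Type*} [RCLike 𝕜] (s : Finset ι) (a : ι → 𝕜) :
    ∃ t ⊆ s, ∑ i ∈ s, ‖a i‖ ≤ 4 * ‖∑ i ∈ t, a i‖ := by
  have part : ∀ (L : 𝕜 →+ ℝ), (∀ x, L x ≤ ‖x‖) →
      ∑ i ∈ s, max (L (a i)) 0 ≤ ‖∑ i ∈ s with 0 ≤ L (a i), a i‖ := by
    intro L hL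
    refine le_trans (le_of_eq ?_) (hL _)
    rw [map_sum, Finset.sum_filter]
    refine Finset.sum_congr rfl fun i _ => ?_
    split_ifs with h
    · exact max_eq_left h
    · exact max_eq_right (not_le.1 h).le
  have h1 := part RCLike.re RCLike.re_le_norm
  have h2 := part (-RCLike.re) fun x => by simpa using RCLike.re_le_norm (-x)
  have h3 := part RCLike.im RCLike.im_le_norm
  have h4 := part (-RCLike.im) fun x => by simpa using RCLike.im_le_norm (-x)
  have habs : ∀ x : ℝ, |x| = max x 0 + max (-x) 0 := fun x => by
    rcases le_total 0 x with h | h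
    · rw [abs_of_nonneg h, max_eq_left h, max_eq_right (by linarith), add_zero]
    · rw [abs_of_nonpos h, max_eq_right h, max_eq_left (by linarith), zero_add]
  have hsum : ∑ i ∈ s, ‖a i‖ ≤ ∑ i ∈ s, max (RCLike.re (a i)) 0 +
      ∑ i ∈ s, max (-RCLike.re (a i)) 0 + ∑ i ∈ s, max (RCLike.im (a i)) 0 +
      ∑ i ∈ s, max (-RCLike.im (a i)) 0 := by
    simp only [← Finset.sum_add_distrib]
    refine Finset.sum_le_sum fun i _ => ?_
    have : ‖a i‖ ≤ |RCLike.re (a i)| + |RCLike.im (a i)| := by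
      calc ‖a i‖ = ‖(RCLike.re (a i) : 𝕜) + RCLike.im (a i) * RCLike.I‖ := by
            rw [RCLike.re_add_im]
        _ ≤ ‖(RCLike.re (a i) : 𝕜)‖ + ‖(RCLike.im (a i) : 𝕜)‖ * ‖(RCLike.I : 𝕜)‖ := by
            rw [← norm_mul]; exact norm_add_le _ _
        _ ≤ |RCLike.re (a i)| + |RCLike.im (a i)| := by
            rw [RCLike.norm_ofReal, RCLike.norm_ofReal]
            gcongr
            refine mul_le_of_le_one_right (abs_nonneg _) ?_
            rw [RCLike.norm_I]
            split_ifs <;> norm_num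
    rw [habs, habs (RCLike.im (a i))] at this
    linarith
  by_contra! hc
  have c1 := hc _ (Finset.filter_subset (fun i => 0 ≤ RCLike.re (a i)) s)
  have c2 := hc _ (Finset.filter_subset (fun i => 0 ≤ (-RCLike.re : 𝕜 →+ ℝ) (a i)) s)
  have c3 := hc _ (Finset.filter_subset (fun i => 0 ≤ RCLike.im (a i)) s)
  have c4 := hc _ (Finset.filter_subset (fun i => 0 ≤ (-RCLike.im : 𝕜 →+ ℝ) (a i)) s)
  simp only [AddMonoidHom.neg_apply] at h1 h2 h3 h4 c1 c2 c3 c4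
  linarith

/-- A bounded sequence with a lower `ℓ₁`-estimate spans a copy of `ℓ₁`. -/
theorem ContainsEllOne.of_seq {𝕜 E : Type*} [RCLike 𝕜] [NormedAddCommGroup E] [NormedSpace 𝕜 E]
    [CompleteSpace E] {e : ℕ → E} {M C : ℝ} (hM : ∀ n, ‖e n‖ ≤ M) (hC : 0 ≤ C)
    (h : ∀ (a : ℕ → 𝕜) (n : ℕ),
      ∑ i ∈ Finset.range n, ‖a i‖ ≤ C * ‖∑ i ∈ Finset.range n, a i • e i‖) :
    ContainsEllOne 𝕜 E := by
  have hnorm : ∀ a : lp (fun _ : ℕ => 𝕜) 1, HasSum (fun i => ‖a i‖) ‖a‖ := fun a => by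
    simpa using lp.hasSum_norm (by simp) a
  have hle : ∀ (a : lp (fun _ : ℕ => 𝕜) 1) i, ‖a i • e i‖ ≤ ‖a i‖ * M := fun a i => by
    rw [norm_smul]
    exact mul_le_mul_of_nonneg_left (hM i) (norm_nonneg _)
  have hsm : ∀ a : lp (fun _ : ℕ => 𝕜) 1, Summable fun i => a i • e i := fun a =>
    Summable.of_norm_bounded ((hnorm a).summable.mul_right M) (hle a)
  let L₀ : lp (fun _ : ℕ => 𝕜) 1 →ₗ[𝕜] E :=
    { toFun := fun a => ∑' i, a i • e i
      map_add' := fun a b => by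
        rw [← (hsm a).tsum_add (hsm b)]
        simp [add_smul]
      map_smul' := fun c a => by
        rw [RingHom.id_apply, ← (hsm a).tsum_const_smul c]
        simp [mul_smul] }
  have hL₀ : ∀ a, ‖L₀ a‖ ≤ M * ‖a‖ := fun a => by
    rw [mul_comm]
    exact tsum_of_norm_bounded ((hnorm a).mul_right M) (hle a)
  let L := L₀.mkContinuous M hL₀
  have hanti : AntilipschitzWith C.toNNReal L := by
    refine L.antilipschitz_of_bound fun a => ?_
    rw [Real.coe_toNNReal _ hC]
    exact le_of_tendsto_of_tendsto' (hnorm a).tendsto_sum_nat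
      ((hsm a).hasSum.tendsto_sum_nat.norm.const_mul C) (h a)
  exact ⟨L, (hanti.isUniformEmbedding L.uniformContinuous).isEmbedding⟩

/-- A convex set that stays away from the origin is separated from it by a functional of norm at
most one, with the same distance. -/
theorem Convex.exists_dual_le_re {𝕜 E : Type*} [RCLike 𝕜] [NormedAddCommGroup E] [NormedSpace 𝕜 E]
    [NormedSpace ℝ E] [IsScalarTower ℝ 𝕜 E] {S : Set E} (hS : Convex ℝ S) {ε : ℝ}
    (h : ∀ p ∈ S, ε ≤ ‖p‖) :
    ∃ k : StrongDual 𝕜 E, ‖k‖ ≤ 1 ∧ ∀ p ∈ S, ε ≤ RCLike.re (k p) := by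
  rcases le_or_gt ε 0 with hε | hε
  · exact ⟨0, by simp, fun p _ => by simpa using hε⟩
  have hdisj : Disjoint (Metric.ball (0 : E) ε) S := by
    rw [Set.disjoint_left]
    intro p hp hpS
    exact (mem_ball_zero_iff.1 hp).not_ge (h p hpS)
  obtain ⟨f, u, hfu, huf⟩ := RCLike.geometric_hahn_banach_open (𝕜 := 𝕜) (convex_ball (0 : E) ε)
    Metric.isOpen_ball hS hdisj
  have hu : ε * ‖f‖ ≤ u := by
    by_contra! hlt
    obtain ⟨x, hx, hfx⟩ := f.exists_lt_apply_of_lt_opNorm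
      (show u / ε < ‖f‖ by rw [div_lt_iff₀ hε]; linarith)
    -- rotate and rescale `x` so that `f` takes a large real value inside the ball
    obtain ⟨c, hc, hcx⟩ := RCLike.exists_norm_eq_mul_self (f x)
    have hmem : ((ε : 𝕜) * c) • x ∈ Metric.ball (0 : E) ε := by
      rw [mem_ball_zero_iff, norm_smul, norm_mul, hc, mul_one,
        RCLike.norm_ofReal, abs_of_pos hε]
      nlinarith
    have := hfu _ hmem
    rw [map_smul, smul_eq_mul, mul_assoc, ← hcx, RCLike.re_ofReal_mul, RCLike.ofReal_re] at this
    rw [div_lt_iff₀ hε] at hfx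
    linarith
  have hf : 0 < u := by simpa using hfu 0 (by simpa using hε)
  rcases (norm_nonneg f).eq_or_lt with h0 | h0
  · have hf0 : f = 0 := norm_eq_zero.1 h0.symm
    refine ⟨0, by simp, fun p hp => ?_⟩
    have := huf p hp
    rw [hf0] at this
    simp at this
    linarith
  · refine ⟨((‖f‖⁻¹ : ℝ) : 𝕜) • f, ?_, fun p hp => ?_⟩
    · rw [norm_smul, RCLike.norm_ofReal, abs_of_pos (inv_pos.2 h0), inv_mul_cancel₀ h0.ne']
    · rw [_root_.smul_apply, smul_eq_mul, RCLike.re_ofReal_mul, inv_mul_eq_div,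
        le_div_iff₀ h0]
      exact hu.trans (huf p hp)

/-- In a Banach space without copies of `ℓ₁`, a bounded weakly null ultrafilter exhausts the dual
ball through the sets on which its members are at least `ε` in modulus. -/
theorem exhausted_of_not_containsEllOne {𝕜 E α : Type*} [RCLike 𝕜] [NormedAddCommGroup E]
    [NormedSpace 𝕜 E] [CompleteSpace E] (hE : ¬ ContainsEllOne 𝕜 E) {𝒰 : Ultrafilter α}
    {g : α → E} {M : ℝ} (hM : ∀ᶠ z in 𝒰, ‖g z‖ ≤ M)
    (hlim : ∀ k : StrongDual 𝕜 E, Tendsto (fun z => k (g z)) 𝒰 (𝓝 0)) {ε : ℝ} (hε : 0 < ε) :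
    Exhausted 𝒰 (fun z => {k : WeakDual.toStrongDual ⁻¹'
      Metric.closedBall (0 : StrongDual 𝕜 E) 1 | k.1 (g z) ∈
        Metric.closedBall (0 : 𝕜) M \ Metric.ball 0 ε}) univ := by
  have : CompactSpace (WeakDual.toStrongDual ⁻¹' Metric.closedBall (0 : StrongDual 𝕜 E) 1) :=
    isCompact_iff_compactSpace.1 (WeakDual.isCompact_closedBall 0 1)
  by_contra hex
  obtain ⟨c, hc, hct⟩ := Exhausted.exists_point_not_exhausted
    (f := fun z (k : WeakDual.toStrongDual ⁻¹' Metric.closedBall (0 : StrongDual 𝕜 E) 1) =>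
      k.1 (g z)) ((isCompact_closedBall (0 : 𝕜) M).diff Metric.isOpen_ball) hex
  have hcε : ε ≤ ‖c‖ := by simpa using hc.2
  have hc0 : 0 < ‖c‖ := hε.trans_le hcε
  -- an eighth of `‖c‖`: the quarter lost in passing to a subfamily, and room for the errors
  obtain ⟨u, hu, hk⟩ := exists_independent_seq
    (fun z => (WeakDual.eval_continuous (g z)).comp continuous_subtype_val)
    (fun k => hlim (WeakDual.toStrongDual k.1)) (show 0 < ‖c‖ / 8 by positivity)
    (hct _ (Metric.closedBall_mem_nhds c (by positivity))) hM
  refine hE (ContainsEllOne.of_seq (𝕜 := 𝕜) hu (C := 8 / ‖c‖) (by positivity) fun a n => ?_)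
  obtain ⟨t, hts, ht⟩ := exists_subset_sum_norm_le (Finset.range n) a
  obtain ⟨k, hkP⟩ := hk (· ∈ t) n
  have hk1 : ‖WeakDual.toStrongDual k.1‖ ≤ 1 := mem_closedBall_zero_iff.1 k.2
  set v := ∑ i ∈ Finset.range n, a i • g (u i) with hv
  set σ := ∑ i ∈ Finset.range n, ‖a i‖ with h_sum
  have hkv : ‖k.1 v‖ ≤ ‖v‖ :=
    ((WeakDual.toStrongDual k.1).le_opNorm v).trans
      (mul_le_of_le_one_left (norm_nonneg _) hk1)
  have hdiff : ‖k.1 v - c * ∑ i ∈ t, a i‖ ≤ ‖c‖ / 8 * σ := by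
    have hite : ∑ i ∈ t, a i = ∑ i ∈ Finset.range n, if i ∈ t then a i else 0 := by
      rw [Finset.sum_ite_mem, Finset.inter_eq_right.2 hts]
    rw [hite, hv, map_sum, Finset.mul_sum, ← Finset.sum_sub_distrib, h_sum,
      Finset.mul_sum]
    refine norm_sum_le_of_le _ fun i hi => ?_
    have := hkP i (Finset.mem_range.1 hi)
    rw [map_smul, smul_eq_mul]
    split_ifs with h
    · rw [mul_comm c, ← mul_sub, norm_mul, mul_comm]
      exact mul_le_mul_of_nonneg_right (this.1 h) (norm_nonneg _)
    · rw [mul_zero, sub_zero, norm_mul, mul_comm]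
      exact mul_le_mul_of_nonneg_right (this.2 h) (norm_nonneg _)
  have h1 : ‖c‖ * ‖∑ i ∈ t, a i‖ ≤ ‖v‖ + ‖c‖ / 8 * σ := by
    rw [← norm_mul]
    have := norm_sub_norm_le (c * ∑ i ∈ t, a i) (k.1 v)
    rw [norm_sub_rev] at this
    linarith
  have h2 := mul_le_mul_of_nonneg_left ht hc0.le
  rw [div_mul_eq_mul_div, le_div_iff₀ hc0]
  linarith

/-- Mazur's theorem for ultrafilters in spaces without copies of `ℓ₁`. The elements of the convex
combination can be chosen one after the other, subject to any condition `G` on finite sets that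
survives the addition of a generic element. -/
theorem exists_convexHull_norm_lt {𝕜 E X : Type*} [RCLike 𝕜] [NormedAddCommGroup E]
    [NormedSpace 𝕜 E] [NormedSpace ℝ E] [IsScalarTower ℝ 𝕜 E] [CompleteSpace E]
    [AddCommGroup X] [Module ℝ X]
    (hE : ¬ ContainsEllOne 𝕜 E) {𝒰 : Ultrafilter X} (g : X →ᵃ[ℝ] E) {M : ℝ}
    (hM : ∀ᶠ z in 𝒰, ‖g z‖ ≤ M)
    (hlim : ∀ k : StrongDual 𝕜 E, Tendsto (fun z => k (g z)) 𝒰 (𝓝 0)) {ε : ℝ} (hε : 0 < ε)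
    [DecidableEq X] {G : Finset X → Prop} (h0 : G ∅)
    (hG : ∀ s, G s → ∀ᶠ z in 𝒰, G (insert z s)) :
    ∃ s, G s ∧ ∃ x ∈ convexHull ℝ (s : Set X), ‖g x‖ < ε := by
  have hex := exhausted_of_not_containsEllOne hE hM hlim hε
  set A := fun z => {k : WeakDual.toStrongDual ⁻¹'
      Metric.closedBall (0 : StrongDual 𝕜 E) 1 | k.1 (g z) ∈
        Metric.closedBall (0 : 𝕜) M \ Metric.ball 0 ε} with hA
  have key : ∀ Q, Exhausted 𝒰 A Q → ∀ s : Finset X, G s → (∀ z ∈ s, ‖g z‖ ≤ M) →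
      (⋂ z ∈ s, A z) ⊆ Q → ∃ s : Finset X, G s ∧ (∀ z ∈ s, ‖g z‖ ≤ M) ∧ (⋂ z ∈ s, A z) = ∅ := by
    intro Q hQ
    induction hQ with
    | empty => exact fun s hs hsM hsQ => ⟨s, hs, hsM, subset_empty_iff.1 hsQ⟩
    | step Q U hU _ ih =>
      intro s hs hsM hsQ
      obtain ⟨z, ⟨hzU, hzM⟩, hz⟩ := (((show ∀ᶠ z in 𝒰, z ∈ U from hU).and hM).and (hG s hs)).exists
      refine ih z hzU (insert z s) hz ?_ ?_
      · simpa [hzM] using hsM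
      · rw [Finset.set_biInter_insert, inter_comm]
        exact inter_subset_inter_left _ hsQ
  obtain ⟨s, hs, hsM, hsA⟩ := key _ hex ∅ h0 (by simp) (subset_univ _)
  refine ⟨s, hs, ?_⟩
  by_contra! hcon
  obtain ⟨k, hk1, hk⟩ := ((convex_convexHull ℝ (s : Set X)).affine_image g).exists_dual_le_re
    (𝕜 := 𝕜) (ε := ε) (by rintro _ ⟨x, hx, rfl⟩; exact hcon x hx)
  have hmem : (⟨StrongDual.toWeakDual k, by simpa using hk1⟩ : WeakDual.toStrongDual ⁻¹'
      Metric.closedBall (0 : StrongDual 𝕜 E) 1) ∈ ⋂ z ∈ s, A z := by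
    refine mem_iInter₂.2 fun z hz => ⟨?_, ?_⟩
    · exact mem_closedBall_zero_iff.2 ((k.le_opNorm _).trans
        ((mul_le_of_le_one_left (norm_nonneg _) hk1).trans (hsM z hz)))
    · intro hlt
      exact (mem_ball_zero_iff.1 hlt).not_ge
        ((hk _ ⟨z, subset_convexHull ℝ _ hz, rfl⟩).trans (RCLike.re_le_norm _))
  rw [hsA] at hmem
  exact hmem

/-! ### Filters stable under successive convex combinations -/

/-- The sets `D` into which convex combinations can be steered by choosing their elements one
after the other: there is a condition `G` on finite sets which holds for `∅`, survives the
addition of an element that is generic for `F`, and confines the convex hull to `D`. A filter with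
`F.convexCore ≤ F` is one all of whose sets have this property. -/
def Filter.convexCore {X : Type*} [AddCommGroup X] [Module ℝ X] (F : Filter X) : Filter X where
  sets := {D | ∃ G : Finset X → Prop, G ∅ ∧
    (∀ s, G s → ∀ᶠ z in F, ∀ t : Finset X, (t : Set X) = insert z ↑s → G t) ∧
    ∀ s, G s → convexHull ℝ (s : Set X) ⊆ D}
  univ_sets := ⟨fun _ => True, trivial, fun _ _ => Eventually.of_forall fun _ _ _ => trivial,
    fun _ _ => subset_univ _⟩
  sets_of_superset := by
    rintro D D' ⟨G, h0, h1, h2⟩ h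
    exact ⟨G, h0, h1, fun s hs => (h2 s hs).trans h⟩
  inter_sets := by
    rintro D D' ⟨G, h0, h1, h2⟩ ⟨G', h0', h1', h2'⟩
    exact ⟨fun s => G s ∧ G' s, ⟨h0, h0'⟩,
      fun s hs => ((h1 s hs.1).and (h1' s hs.2)).mono fun z hz t ht => ⟨hz.1 t ht, hz.2 t ht⟩,
      fun s hs => subset_inter (h2 s hs.1) (h2' s hs.2)⟩

namespace Filter

variable {X : Type*} [AddCommGroup X] [Module ℝ X] {F F₁ F₂ : Filter X} {D : Set X}

theorem mem_convexCore [DecidableEq X] : D ∈ F.convexCore ↔ ∃ G : Finset X → Prop, G ∅ ∧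
    (∀ s, G s → ∀ᶠ z in F, G (insert z s)) ∧ ∀ s, G s → convexHull ℝ (s : Set X) ⊆ D := by
  refine exists_congr fun G => and_congr_right fun _ => and_congr_left fun _ =>
    forall₂_congr fun s _ => eventually_congr (Eventually.of_forall fun z => ?_)
  constructor
  · exact fun h => h _ (Finset.coe_insert z s)
  · intro h t ht
    have : t = insert z s := Finset.coe_injective (by rw [ht, Finset.coe_insert])
    exact this ▸ h

theorem convexCore_mono (h : F₁ ≤ F₂) : F₁.convexCore ≤ F₂.convexCore := by
  rintro D ⟨G, h0, h1, h2⟩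
  exact ⟨G, h0, fun s hs => (h1 s hs).filter_mono h, h2⟩

theorem convexCore_inf_le (h₁ : F₁.convexCore ≤ F₁) (h₂ : F₂.convexCore ≤ F₂) :
    (F₁ ⊓ F₂).convexCore ≤ F₁ ⊓ F₂ :=
  le_inf ((convexCore_mono inf_le_left).trans h₁) ((convexCore_mono inf_le_right).trans h₂)

theorem mem_convexCore_of_convex (hD : Convex ℝ D) (hDF : D ∈ F) : D ∈ F.convexCore := by
  classical
  refine mem_convexCore.2 ⟨fun s => (s : Set X) ⊆ D, by simp, fun s hs => ?_,
    fun s hs => convexHull_min hs hD⟩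
  filter_upwards [hDF] with z hz
  rw [Finset.coe_insert]
  exact insert_subset hz hs

theorem convexCore_comap_nhds_le {V : Type*} [AddCommGroup V] [Module ℝ V] [TopologicalSpace V]
    [LocallyConvexSpace ℝ V] {L : X → V} (hL : IsLinearMap ℝ L) (v : V) :
    (comap L (𝓝 v)).convexCore ≤ comap L (𝓝 v) := by
  rintro D ⟨W, hW, hWD⟩
  obtain ⟨W', ⟨hW', hconv⟩, hsub⟩ := (LocallyConvexSpace.convex_basis (𝕜 := ℝ) v).mem_iff.1 hW
  exact mem_of_superset (mem_convexCore_of_convex (hconv.is_linear_preimage hL)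
    (preimage_mem_comap hW')) ((preimage_mono hsub).trans hWD)

end Filter

/-! ### The filter of generic points of the unit ball -/

/-- The filter of generic elements `z` of the unit ball: `‖w + z‖` is close to its maximal possible
value `‖w‖ + 1`, for any finite number of vectors `w`. -/
def genericFilter (X : Type*) [NormedAddCommGroup X] : Filter X :=
  𝓟 (Metric.closedBall 0 1) ⊓
    ⨅ p : X × Ioi (0 : ℝ), 𝓟 {z | ‖p.1‖ + 1 - p.2 < ‖p.1 + z‖}

section Generic

variable {X : Type*} [NormedAddCommGroup X]

theorem eventually_generic_norm_le : ∀ᶠ z in genericFilter X, ‖z‖ ≤ 1 := by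
  have : ∀ᶠ z in genericFilter X, z ∈ Metric.closedBall (0 : X) 1 :=
    mem_inf_of_left (mem_principal_self _)
  exact this.mono fun z hz => mem_closedBall_zero_iff.1 hz

theorem eventually_generic_lt_norm_add (w : X) {δ : ℝ} (hδ : 0 < δ) :
    ∀ᶠ z in genericFilter X, ‖w‖ + 1 - δ < ‖w + z‖ :=
  mem_inf_of_right (mem_iInf_of_mem (w, ⟨δ, hδ⟩) (mem_principal_self _))

theorem eventually_generic_forall_compact {C : Set X} (hC : IsCompact C) {δ : ℝ} (hδ : 0 < δ) :
    ∀ᶠ z in genericFilter X, ∀ u ∈ C, ‖u‖ + 1 - δ < ‖u + z‖ := by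
  refine hC.induction_on (p := fun S => ∀ᶠ z in genericFilter X, ∀ u ∈ S, ‖u‖ + 1 - δ < ‖u + z‖)
    (by simp) (fun s t hst ht => ht.mono fun z hz u hu => hz u (hst hu))
    (fun s t hs ht => (hs.and ht).mono fun z hz u hu => hu.elim (hz.1 u) (hz.2 u)) fun u _ => ?_
  refine ⟨Metric.ball u (δ / 3),
    mem_nhdsWithin_of_mem_nhds (Metric.ball_mem_nhds u (by positivity)),
    (eventually_generic_lt_norm_add u (show 0 < δ / 3 by positivity)).mono fun z hz v hv => ?_⟩
  rw [mem_ball_iff_norm] at hv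
  have h1 : ‖v‖ ≤ ‖u‖ + ‖v - u‖ := norm_le_insert' v u
  have h2 : ‖u + z‖ ≤ ‖v + z‖ + ‖v - u‖ := by
    rw [norm_sub_rev v u]
    have := norm_add_le (v + z) (u - v)
    rwa [show v + z + (u - v) = u + z by abel] at this
  linarith

theorem convexCore_genericFilter_le [NormedSpace ℝ X] :
    (genericFilter X).convexCore ≤ genericFilter X := by
  classical
  refine le_inf ?_ (le_iInf ?_)
  · refine le_principal_iff.2 (mem_convexCore_of_convex (convex_closedBall _ _) ?_)
    exact mem_inf_of_left (mem_principal_self _)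
  rintro ⟨w, δ, hδ : 0 < δ⟩
  refine le_principal_iff.2 (mem_convexCore.2 ⟨fun s => ∃ δ' < δ, ∀ l : X → ℝ,
    (∀ x, l x ∈ Icc (0 : ℝ) 1) → ‖w‖ + ∑ x ∈ s, l x - δ' ≤ ‖w + ∑ x ∈ s, l x • x‖, ?_, ?_, ?_⟩)
  · exact ⟨0, hδ, by simp⟩
  · rintro s ⟨δ', hδ', hs⟩
    have hC : IsCompact ((fun l : X → ℝ => w + ∑ x ∈ s, l x • x) ''
        univ.pi fun _ => Icc (0 : ℝ) 1) :=
      (isCompact_univ_pi fun _ => isCompact_Icc).image (by fun_prop)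
    have hη : 0 < (δ - δ') / 2 := by linarith
    filter_upwards [eventually_generic_forall_compact hC hη, eventually_generic_norm_le]
      with z hz hz1
    by_cases hzs : z ∈ s
    · rw [Finset.insert_eq_of_mem hzs]
      exact ⟨δ', hδ', hs⟩
    refine ⟨δ' + (δ - δ') / 2, by linarith, fun l hl => ?_⟩
    rw [Finset.sum_insert hzs, Finset.sum_insert hzs]
    set u := w + ∑ x ∈ s, l x • x with hu
    have h1 := hz u ⟨l, fun x _ => hl x, rfl⟩
    have h2 := hs l hl
    have h3 : ‖u + z‖ ≤ ‖u + l z • z‖ + (1 - l z) := by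
      have h4 : ‖(1 - l z) • z‖ ≤ 1 - l z := by
        rw [norm_smul, Real.norm_of_nonneg (by linarith [(hl z).2])]
        exact mul_le_of_le_one_right (by linarith [(hl z).2]) hz1
      have := norm_add_le (u + l z • z) ((1 - l z) • z)
      rw [show u + l z • z + (1 - l z) • z = u + z by rw [sub_smul, one_smul]; abel] at this
      linarith
    rw [show w + (l z • z + ∑ x ∈ s, l x • x) = u + l z • z by rw [hu]; abel]
    linarith
  · rintro s ⟨δ', hδ', hs⟩ x hx
    obtain ⟨l, hl0, hl1, rfl⟩ := Finset.mem_convexHull'.1 hx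
    have hle : ∀ x ∈ s, l x ≤ 1 := fun x hx => hl1 ▸ Finset.single_le_sum hl0 hx
    have := hs (fun x => if x ∈ s then l x else 0) fun x => by
      split_ifs with h
      exacts [⟨hl0 x h, hle x h⟩, ⟨le_rfl, zero_le_one⟩]
    rw [Finset.sum_congr rfl fun x hx => if_pos hx, hl1,
      Finset.sum_congr rfl fun x hx => by rw [if_pos hx]] at this
    change ‖w‖ + 1 - δ < _
    linarith

end Generic

/-! ### Generic points in slices and in weak neighbourhoods -/

section Daugavet

variable {𝕜 X : Type*} [RCLike 𝕜] [NormedAddCommGroup X] [NormedSpace 𝕜 X]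

/-- The Daugavet equation for a rank one operator, with the operator written as `φ ⊗ w`. -/
theorem IsDaugavetSpace.norm_id_add_smulRight (hX : IsDaugavetSpace 𝕜 X) {φ : StrongDual 𝕜 X}
    (hφ : φ ≠ 0) {w : X} (hw : w ≠ 0) :
    ‖ContinuousLinearMap.id 𝕜 X + φ.smulRight w‖ = 1 + ‖φ‖ * ‖w‖ := by
  rw [hX, ContinuousLinearMap.norm_smulRight_apply]
  have hr : LinearMap.range ((φ.smulRight w : X →L[𝕜] X) : X →ₗ[𝕜] X) = 𝕜 ∙ w := by
    obtain ⟨x, hx⟩ := DFunLike.ne_iff.1 hφ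
    ext y
    rw [LinearMap.mem_range, Submodule.mem_span_singleton]
    constructor
    · rintro ⟨z, rfl⟩
      exact ⟨φ z, rfl⟩
    · rintro ⟨c, rfl⟩
      refine ⟨(c / φ x) • x, ?_⟩
      change φ ((c / φ x) • x) • w = c • w
      rw [map_smul, smul_eq_mul, div_mul_cancel₀ _ hx]
  rw [LinearMap.rank, hr, Module.rank_eq_one_iff_finrank_eq_one, finrank_span_singleton hw]

/-- In a Daugavet space every slice of the ball contains a smaller slice that consists of elements
`z` with `‖w + z‖` almost maximal. -/
theorem IsDaugavetSpace.exists_subslice (hX : IsDaugavetSpace 𝕜 X) {φ : StrongDual 𝕜 X} {a : ℝ}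
    (ha : 0 ≤ a) (haφ : a < ‖φ‖) (w : X) {δ : ℝ} (hδ : 0 < δ) :
    ∃ (ψ : StrongDual 𝕜 X) (b : ℝ), 0 ≤ b ∧ b < ‖ψ‖ ∧ ∀ z, ‖z‖ ≤ 1 → b < RCLike.re (ψ z) →
      a < RCLike.re (φ z) ∧ ‖w‖ + 1 - δ < ‖w + z‖ := by
  have hφ : 0 < ‖φ‖ := ha.trans_lt haφ
  rcases eq_or_ne w 0 with rfl | hw
  · refine ⟨φ, max a (‖φ‖ * (1 - δ)), le_max_of_le_left ha, max_lt haφ ?_, fun z hz hb => ?_⟩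
    · nlinarith
    · rw [max_lt_iff] at hb
      refine ⟨hb.1, ?_⟩
      have h1 := (RCLike.re_le_norm (φ z)).trans (φ.le_opNorm z)
      have : 1 - δ < ‖z‖ := lt_of_mul_lt_mul_left (hb.2.trans_le h1) hφ.le
      simpa using this
  have hw0 : 0 < ‖w‖ := norm_pos_iff.2 hw
  obtain ⟨η, hη0, hη1, hη2⟩ : ∃ η > 0, η ≤ (‖φ‖ - a) * ‖w‖ ∧ η * (1 + 1 / ‖φ‖) ≤ δ := by
    refine ⟨min ((‖φ‖ - a) * ‖w‖) (δ / (1 + 1 / ‖φ‖)), lt_min ?_ ?_, min_le_left _ _, ?_⟩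
    · exact mul_pos (by linarith) hw0
    · positivity
    · rw [← le_div_iff₀ (by positivity)]
      exact min_le_right _ _
  have haw : 0 ≤ a * ‖w‖ := by positivity
  -- a functional `g` for which `g + g(w) φ`, the adjoint of `id + φ ⊗ w` at `g`, is almost as large
  -- as possible
  obtain ⟨g, hg1, hgw, hg⟩ : ∃ g : StrongDual 𝕜 X, ‖g‖ ≤ 1 ∧ (‖g w‖ : 𝕜) = g w ∧
      1 + ‖φ‖ * ‖w‖ - η < ‖g + g w • φ‖ := by
    obtain ⟨x, hx1, hx⟩ := ContinuousLinearMap.exists_lt_apply_of_lt_opNorm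
      (ContinuousLinearMap.id 𝕜 X + φ.smulRight w) (r := 1 + ‖φ‖ * ‖w‖ - η)
      (by rw [hX.norm_id_add_smulRight (norm_pos_iff.1 hφ) hw]; linarith)
    obtain ⟨g, hg1, hg⟩ := exists_dual_vector'' 𝕜 ((ContinuousLinearMap.id 𝕜 X + φ.smulRight w) x)
    obtain ⟨c, hc1, hc⟩ := RCLike.exists_norm_eq_mul_self (g w)
    refine ⟨c • g, by rwa [norm_smul, hc1, one_mul], ?_, ?_⟩
    · simp [hc, hc1]
    · have hcg : c • g + (c • g) w • φ = c • (g + g w • φ) := by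
        ext z
        simp only [_root_.add_apply, _root_.smul_apply, smul_eq_mul]
        ring
      rw [hcg, norm_smul, hc1, one_mul]
      refine hx.trans_le ?_
      have h1 : (g + g w • φ) x = g ((ContinuousLinearMap.id 𝕜 X + φ.smulRight w) x) := by
        simp [mul_comm]
      have h2 := (g + g w • φ).le_opNorm x
      rw [h1, hg, RCLike.norm_ofReal, abs_norm] at h2
      exact h2.trans (mul_le_of_le_one_right (norm_nonneg _) hx1.le)
  have hgw1 : ‖g w‖ ≤ ‖w‖ := (g.le_opNorm w).trans (mul_le_of_le_one_left hw0.le hg1)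
  have hgw2 : ‖w‖ - η / ‖φ‖ < ‖g w‖ := by
    have := norm_add_le g (g w • φ)
    rw [norm_smul] at this
    rw [sub_lt_iff_lt_add, ← sub_lt_iff_lt_add', lt_div_iff₀ hφ]
    linarith
  refine ⟨g + g w • φ, 1 + ‖φ‖ * ‖w‖ - η, by linarith, hg, fun z hz hb => ?_⟩
  have hre : RCLike.re ((g + g w • φ) z) = RCLike.re (g z) + ‖g w‖ * RCLike.re (φ z) := by
    rw [_root_.add_apply, _root_.smul_apply, map_add, smul_eq_mul, ← hgw, RCLike.re_ofReal_mul,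
      hgw]
  rw [hre] at hb
  have hgz : RCLike.re (g z) ≤ 1 := (RCLike.re_le_norm _).trans
    ((g.le_opNorm z).trans (mul_le_one₀ hg1 (norm_nonneg _) hz))
  have hφz : RCLike.re (φ z) ≤ ‖φ‖ := (RCLike.re_le_norm _).trans
    ((φ.le_opNorm z).trans (mul_le_of_le_one_right hφ.le hz))
  have hpos : 0 < RCLike.re (φ z) := by
    by_contra! h
    have := mul_nonpos_of_nonneg_of_nonpos (norm_nonneg (g w)) h
    linarith
  constructor
  · have h1 := mul_le_mul_of_nonneg_right hgw1 hpos.le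
    have h2 : a * ‖w‖ < RCLike.re (φ z) * ‖w‖ := by linarith
    exact lt_of_mul_lt_mul_right h2 hw0.le
  · have h1 : ‖g w‖ * RCLike.re (φ z) ≤ ‖w‖ * ‖φ‖ := mul_le_mul hgw1 hφz hpos.le hw0.le
    have h2 : RCLike.re (g (w + z)) ≤ ‖w + z‖ := (RCLike.re_le_norm _).trans
      ((g.le_opNorm _).trans (mul_le_of_le_one_left (norm_nonneg _) hg1))
    rw [map_add, map_add, ← hgw, RCLike.ofReal_re] at h2
    rw [mul_add, mul_one, mul_one_div] at hη2
    linarith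

theorem IsDaugavetSpace.neBot_generic_inf_slice_of_nonneg (hX : IsDaugavetSpace 𝕜 X)
    {φ : StrongDual 𝕜 X} {a : ℝ} (ha : 0 ≤ a) (haφ : a < ‖φ‖) :
    (genericFilter X ⊓ 𝓟 {z | a < RCLike.re (φ z)}).NeBot := by
  classical
  have key : ∀ (R : Finset (X × Ioi (0 : ℝ))) (φ : StrongDual 𝕜 X) (a : ℝ), 0 ≤ a → a < ‖φ‖ →
      ∃ z, ‖z‖ ≤ 1 ∧ a < RCLike.re (φ z) ∧ ∀ p ∈ R, ‖p.1‖ + 1 - p.2 < ‖p.1 + z‖ := by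
    intro R
    induction R using Finset.induction_on with
    | empty =>
      intro φ a ha haφ
      obtain ⟨x, hx1, hx⟩ := φ.exists_lt_apply_of_lt_opNorm haφ
      obtain ⟨c, hc1, hc⟩ := RCLike.exists_norm_eq_mul_self (φ x)
      refine ⟨c • x, by rw [norm_smul, hc1, one_mul]; exact hx1.le, ?_, by simp⟩
      rwa [map_smul, smul_eq_mul, ← hc, RCLike.ofReal_re]
    | insert p R _ ih =>
      intro φ a ha haφ
      obtain ⟨ψ, b, hb, hbψ, h⟩ := hX.exists_subslice ha haφ p.1 p.2.2
      obtain ⟨z, hz1, hz, hR⟩ := ih ψ b hb hbψ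
      obtain ⟨h1, h2⟩ := h z hz1 hz
      exact ⟨z, hz1, h1, Finset.forall_mem_insert _ _ _ |>.2 ⟨h2, hR⟩⟩
  rw [inf_principal_neBot_iff]
  intro U hU
  obtain ⟨V, hV, W, hW, rfl⟩ := mem_inf_iff.1 hU
  obtain ⟨R, hR⟩ := (mem_iInf_finite _).1 hW
  rw [iInf_principal_finset, mem_principal] at hR
  obtain ⟨z, hz1, hz, hzR⟩ := key R φ a ha haφ
  exact ⟨z, ⟨hV (mem_closedBall_zero_iff.2 hz1), hR (mem_iInter₂.2 hzR)⟩, hz⟩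

theorem IsDaugavetSpace.neBot_generic_inf_slice [Nontrivial X] (hX : IsDaugavetSpace 𝕜 X)
    {φ : StrongDual 𝕜 X} {a : ℝ} (haφ : a < ‖φ‖) :
    (genericFilter X ⊓ 𝓟 {z | a < RCLike.re (φ z)}).NeBot := by
  rcases eq_or_ne φ 0 with rfl | hφ
  · obtain ⟨x, hx⟩ := exists_ne (0 : X)
    obtain ⟨ψ, hψ, -⟩ := exists_dual_vector 𝕜 x (norm_ne_zero_iff.2 hx)
    have := hX.neBot_generic_inf_slice_of_nonneg (φ := ψ) le_rfl (by rw [hψ]; exact one_pos)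
    refine this.mono (inf_le_inf_left _ (principal_mono.2 fun z _ => ?_))
    simpa using haφ
  · refine (hX.neBot_generic_inf_slice_of_nonneg (φ := φ) (le_max_right a 0)
      (max_lt haφ (norm_pos_iff.2 hφ))).mono (inf_le_inf_left _ (principal_mono.2 fun z hz => ?_))
    exact (le_max_left a 0).trans_lt hz

/-- The evaluation map of `X` into the scalar functions on its dual; the topology which it induces
on `X` from the product topology is the weak one. -/
def dualEval (𝕜 X : Type*) [RCLike 𝕜] [NormedAddCommGroup X] [NormedSpace 𝕜 X] :
    X →L[𝕜] (StrongDual 𝕜 X → 𝕜) :=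
  ContinuousLinearMap.pi fun φ => φ

/-- Every point of the unit ball is a weak cluster point of the generic filter: the cluster points
form a closed convex set, and they cannot be separated from a point of the ball because every slice
contains generic points. -/
theorem IsDaugavetSpace.mapClusterPt_generic [Nontrivial X] [NormedSpace ℝ X]
    [IsScalarTower ℝ 𝕜 X] (hX : IsDaugavetSpace 𝕜 X) {y : X} (hy : ‖y‖ ≤ 1) :
    MapClusterPt (dualEval 𝕜 X y) (genericFilter X) (dualEval 𝕜 X) := by
  set H := {h | MapClusterPt h (genericFilter X) (dualEval 𝕜 X)} with hH
  have hcl : IsClosed H := isClosed_setOfPred_clusterPt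
  have hconv : Convex ℝ H := by
    classical
    intro h₁ hh₁ h₂ hh₂ a b ha hb hab
    refine mapClusterPt_iff_frequently.2 fun V hV => ?_
    have hcont : Tendsto (fun p : (StrongDual 𝕜 X → 𝕜) × (StrongDual 𝕜 X → 𝕜) =>
        a • p.1 + b • p.2) (𝓝 h₁ ×ˢ 𝓝 h₂) (𝓝 (a • h₁ + b • h₂)) := by
      rw [← nhds_prod_eq]
      exact (by fun_prop : Continuous fun p : (StrongDual 𝕜 X → 𝕜) × (StrongDual 𝕜 X → 𝕜) =>
        a • p.1 + b • p.2).tendsto _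
    obtain ⟨V₁, hV₁, V₂, hV₂, hV12⟩ := mem_prod_iff.1 (hcont hV)
    rw [frequently_iff]
    intro D hD
    obtain ⟨G, h0, h1, h2⟩ := mem_convexCore.1 (convexCore_genericFilter_le hD)
    obtain ⟨z₁, hz₁, hG₁⟩ := ((mapClusterPt_iff_frequently.1 hh₁ V₁ hV₁).and_eventually
      (h1 _ h0)).exists
    obtain ⟨z₂, hz₂, hG₂⟩ := ((mapClusterPt_iff_frequently.1 hh₂ V₂ hV₂).and_eventually
      (h1 _ hG₁)).exists
    refine ⟨a • z₁ + b • z₂, h2 _ hG₂ ?_, ?_⟩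
    · exact convex_convexHull ℝ _ (subset_convexHull ℝ _ (by simp))
        (subset_convexHull ℝ _ (by simp)) ha hb hab
    · have : dualEval 𝕜 X (a • z₁ + b • z₂) = a • dualEval 𝕜 X z₁ + b • dualEval 𝕜 X z₂ := by
        ext φ
        simp [dualEval]
      rw [this]
      exact hV12 (mk_mem_prod hz₁ hz₂)
  by_contra hyH
  obtain ⟨l, u, hlu, hl⟩ := RCLike.geometric_hahn_banach_closed_point (𝕜 := 𝕜) hconv hcl hyH
  set φ : StrongDual 𝕜 X := l.comp (dualEval 𝕜 X) with hφ
  have huφ : u < ‖φ‖ := hl.trans_le ((RCLike.re_le_norm (φ y)).trans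
    ((φ.le_opNorm y).trans (mul_le_of_le_one_right (norm_nonneg _) hy)))
  have := hX.neBot_generic_inf_slice huφ
  have hK : IsCompact (univ.pi fun ψ : StrongDual 𝕜 X => Metric.closedBall (0 : 𝕜) ‖ψ‖) :=
    isCompact_univ_pi fun ψ => isCompact_closedBall _ _
  have hle : map (dualEval 𝕜 X) (genericFilter X ⊓ 𝓟 {z | u < RCLike.re (φ z)}) ≤
      𝓟 (univ.pi fun ψ : StrongDual 𝕜 X => Metric.closedBall (0 : 𝕜) ‖ψ‖) := by
    refine le_principal_iff.2 (mem_map.2 (mem_inf_of_left ?_))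
    filter_upwards [eventually_generic_norm_le] with z hz ψ _
    exact mem_closedBall_zero_iff.2
      ((ψ.le_opNorm z).trans (mul_le_of_le_one_right (norm_nonneg _) hz))
  obtain ⟨h, -, hh⟩ := hK hle
  refine (hlu h (hh.mono (map_mono inf_le_left))).not_ge ?_
  have hcl' : IsClosed {h | u ≤ RCLike.re (l h)} :=
    isClosed_le continuous_const (RCLike.continuous_re.comp l.continuous)
  refine hcl'.closure_subset (mem_closure_iff_clusterPt.2 (hh.mono ?_))
  refine le_principal_iff.2 (mem_map.2 (mem_inf_of_right (mem_principal.2 ?_)))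
  exact fun z (hz : u < RCLike.re (φ z)) => hz.le

end Daugavet

/-! ### Operators into spaces without copies of `ℓ₁` -/

section Narrow

variable {𝕜 X : Type*} [RCLike 𝕜] [NormedAddCommGroup X] [NormedSpace 𝕜 X]

/-- If a filter on the unit ball converges weakly to `y` and is stable under successive convex
combinations, then `T y` is a norm cluster point of its image under any operator `T` into a space
without copies of `ℓ₁`. -/
theorem neBot_inf_comap_nhds [NormedSpace ℝ X] [IsScalarTower ℝ 𝕜 X] {E : Type*}
    [NormedAddCommGroup E] [NormedSpace 𝕜 E] [CompleteSpace E] (hE : ¬ ContainsEllOne 𝕜 E)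
    (T : X →L[𝕜] E) {y : X} {F : Filter X} [F.NeBot] (hF : F.convexCore ≤ F)
    (hball : ∀ᶠ z in F, ‖z‖ ≤ 1) (hweak : Tendsto (dualEval 𝕜 X) F (𝓝 (dualEval 𝕜 X y))) :
    (F ⊓ comap T (𝓝 (T y))).NeBot := by
  classical
  let _ : NormedSpace ℝ E := NormedSpace.restrictScalars ℝ 𝕜 E
  have _ : IsScalarTower ℝ 𝕜 E := RestrictScalars.isScalarTower ℝ 𝕜 E
  rw [inf_neBot_iff]
  rintro D hD _ ⟨V, hV, hVW⟩
  obtain ⟨ε, hε, hεV⟩ := Metric.mem_nhds_iff.1 hV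
  obtain ⟨G, h0, h1, h2⟩ := mem_convexCore.1 (hF hD)
  let g : X →ᵃ[ℝ] E :=
    ((T : X →ₗ[𝕜] E).restrictScalars ℝ).toAffineMap - AffineMap.const ℝ X (T y)
  have hg : ∀ z, g z = T z - T y := fun z => rfl
  have hle : (Ultrafilter.of F : Filter X) ≤ F := Ultrafilter.of_le F
  have hM : ∀ᶠ z in Ultrafilter.of F, ‖g z‖ ≤ ‖T‖ + ‖T y‖ := by
    filter_upwards [hball.filter_mono hle] with z hz
    rw [hg]
    refine (norm_sub_le _ _).trans (add_le_add_left ?_ _)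
    exact (T.le_opNorm z).trans (mul_le_of_le_one_right (norm_nonneg _) hz)
  have hlim : ∀ k : StrongDual 𝕜 E, Tendsto (fun z => k (g z)) (Ultrafilter.of F) (𝓝 0) := by
    intro k
    have h := (tendsto_pi_nhds.1 (hweak.mono_left hle) (k.comp T)).sub_const (k (T y))
    simpa [hg, dualEval] using h
  obtain ⟨s, hs, x, hx, hgx⟩ := exists_convexHull_norm_lt hE g hM hlim hε h0
    fun s hs => (h1 s hs).filter_mono hle
  refine ⟨x, h2 s hs hx, hVW (hεV ?_)⟩
  rwa [mem_ball_iff_norm, ← hg]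

/-- In a Daugavet space, an element `y` of the unit ball can be replaced by an element `z` of the
ball that is almost `ℓ₁`-orthogonal to a given vector, while its images under finitely many
operators into spaces without copies of `ℓ₁` hardly change. -/
theorem IsDaugavetSpace.exists_generic_near [Nontrivial X] (hX : IsDaugavetSpace 𝕜 X)
    {ι : Type*} {E : ι → Type*} [∀ i, NormedAddCommGroup (E i)] [∀ i, NormedSpace 𝕜 (E i)]
    [∀ i, CompleteSpace (E i)] (hE : ∀ i, ¬ ContainsEllOne 𝕜 (E i)) (T : ∀ i, X →L[𝕜] E i)
    (s : Finset ι) {y : X} (hy : ‖y‖ ≤ 1) (w : X) {δ : ℝ} (hδ : 0 < δ) :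
    ∃ z, ‖z‖ ≤ 1 ∧ ‖w‖ + 1 - δ < ‖w + z‖ ∧ ∀ i ∈ s, ‖T i z - T i y‖ < δ := by
  classical
  let _ : NormedSpace ℝ X := NormedSpace.restrictScalars ℝ 𝕜 X
  have _ : IsScalarTower ℝ 𝕜 X := RestrictScalars.isScalarTower ℝ 𝕜 X
  obtain ⟨F, hne, hF, hgen, hweak, hT⟩ : ∃ F : Filter X, F.NeBot ∧ F.convexCore ≤ F ∧
      F ≤ genericFilter X ∧ Tendsto (dualEval 𝕜 X) F (𝓝 (dualEval 𝕜 X y)) ∧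
      ∀ i ∈ s, Tendsto (T i) F (𝓝 (T i y)) := by
    induction s using Finset.induction_on with
    | empty =>
      refine ⟨genericFilter X ⊓ comap (dualEval 𝕜 X) (𝓝 (dualEval 𝕜 X y)), ?_, ?_, inf_le_left,
        tendsto_comap.mono_left inf_le_right, by simp⟩
      · have := hX.mapClusterPt_generic hy
        rwa [MapClusterPt, ClusterPt, inf_comm, ← Filter.push_pull, map_neBot_iff] at this
      · exact convexCore_inf_le convexCore_genericFilter_le
          (convexCore_comap_nhds_le (V := StrongDual 𝕜 X → 𝕜)
            ⟨map_add _, fun c x => map_real_smul (dualEval 𝕜 X) (dualEval 𝕜 X).continuous c x⟩ _)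
    | insert i s _ ih =>
      obtain ⟨F, hne, hF, hgen, hweak, hT⟩ := ih
      let _ : NormedSpace ℝ (E i) := NormedSpace.restrictScalars ℝ 𝕜 (E i)
      have _ : IsScalarTower ℝ 𝕜 (E i) := RestrictScalars.isScalarTower ℝ 𝕜 (E i)
      refine ⟨F ⊓ comap (T i) (𝓝 (T i y)), neBot_inf_comap_nhds (hE i) (T i) hF
        (hgen eventually_generic_norm_le) hweak, ?_, inf_le_left.trans hgen,
        hweak.mono_left inf_le_left, ?_⟩
      · exact convexCore_inf_le hF
          (convexCore_comap_nhds_le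
            ⟨map_add _, fun c x => map_real_smul (T i) (T i).continuous c x⟩ _)
      · refine Finset.forall_mem_insert _ _ _ |>.2 ⟨tendsto_comap.mono_left inf_le_right, ?_⟩
        exact fun k hk => (hT k hk).mono_left inf_le_left
  have hT' : ∀ᶠ z in F, ∀ i ∈ s, ‖T i z - T i y‖ < δ := by
    refine (Finset.eventually_all s).2 fun i hi => ?_
    filter_upwards [hT i hi (Metric.ball_mem_nhds _ hδ)] with z hz
    exact mem_ball_iff_norm.1 hz
  exact ((eventually_generic_norm_le.filter_mono hgen).and
    (((eventually_generic_lt_norm_add w hδ).filter_mono hgen).and hT')).exists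

end Narrow

/-! ### Projections of an unconditional sum -/

theorem ContinuousLinearMap.exists_antilipschitz_of_isEmbedding {𝕜 V W : Type*} [RCLike 𝕜]
    [NormedAddCommGroup V] [NormedSpace 𝕜 V] [NormedAddCommGroup W] [NormedSpace 𝕜 W]
    {T : V →L[𝕜] W} (hT : IsEmbedding T) : ∃ C, AntilipschitzWith C T := by
  have h : Metric.ball (0 : V) 1 ∈ 𝓝 0 := Metric.ball_mem_nhds _ one_pos
  rw [hT.isInducing.nhds_eq_comap, map_zero] at h
  obtain ⟨U, hU, hUV⟩ := h
  obtain ⟨ε, hε, hεU⟩ := Metric.mem_nhds_iff.1 hU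
  refine ⟨(ε⁻¹).toNNReal, T.antilipschitz_of_bound fun x => ?_⟩
  rw [Real.coe_toNNReal _ (by positivity), inv_mul_eq_div, le_div_iff₀ hε]
  by_contra! hlt
  have hx : 0 < ‖x‖ := by
    by_contra! h0
    nlinarith [norm_nonneg (T x)]
  have hnorm : ‖((‖x‖⁻¹ : ℝ) : 𝕜)‖ = ‖x‖⁻¹ := by
    rw [RCLike.norm_ofReal, abs_of_pos (inv_pos.2 hx)]
  have hmem : ((‖x‖⁻¹ : ℝ) : 𝕜) • x ∈ T ⁻¹' U := by
    refine hεU ?_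
    rw [mem_ball_zero_iff, map_smul, norm_smul, hnorm, inv_mul_lt_iff₀ hx]
    linarith
  have := mem_ball_zero_iff.1 (hUV hmem)
  rw [norm_smul, hnorm, inv_mul_cancel₀ hx.ne'] at this
  exact this.false

theorem Summable.exists_norm_sum_le {ι Z : Type*} [NormedAddCommGroup Z] {f : ι → Z}
    (hf : Summable f) : ∃ C, ∀ B : Finset ι, ‖∑ i ∈ B, f i‖ ≤ C := by
  classical
  obtain ⟨s, hs⟩ := hf.vanishing (Metric.ball_mem_nhds (0 : Z) one_pos)
  refine ⟨∑ i ∈ s, ‖f i‖ + 1, fun B => ?_⟩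
  rw [← Finset.sum_inter_add_sum_sdiff B s]
  refine (norm_add_le _ _).trans (add_le_add ?_ ?_)
  · exact (norm_sum_le _ _).trans (Finset.sum_le_sum_of_subset_of_nonneg
      Finset.inter_subset_right fun _ _ _ => norm_nonneg _)
  · exact (mem_ball_zero_iff.1 (hs _ Finset.sdiff_disjoint)).le

/-- The coordinates of an unconditional sum are continuous, and the partial sums over all finite
sets of indices are uniformly bounded. This follows from the closed graph theorem, applied to the
operator that maps `z` to the family of all its finite partial sums. -/
theorem IsUnconditionalSum.exists_projections {𝕜 ι Z : Type*} {E : ι → Type*} [RCLike 𝕜]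
    [NormedAddCommGroup Z] [NormedSpace 𝕜 Z] [CompleteSpace Z]
    [∀ i, NormedAddCommGroup (E i)] [∀ i, NormedSpace 𝕜 (E i)] [∀ i, CompleteSpace (E i)]
    {j : ∀ i, E i →L[𝕜] Z} (hZ : IsUnconditionalSum j) :
    ∃ P : ∀ i, Z →L[𝕜] E i, (∀ z, HasSum (fun i => j i (P i z)) z) ∧
      ∃ K, ∀ (B : Finset ι) z, ‖∑ i ∈ B, j i (P i z)‖ ≤ K * ‖z‖ := by
  choose c hc huniq using hZ.existsUnique_hasSum
  simp only at hc huniq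
  have hadd : ∀ z z', c (z + z') = c z + c z' := fun z z' =>
    (huniq _ _ (by simpa using (hc z).add (hc z'))).symm
  have hsmul : ∀ (a : 𝕜) z, c (a • z) = a • c z := fun a z =>
    (huniq _ _ (by simpa using (hc z).const_smul a)).symm
  let S : Z →ₗ[𝕜] lp (fun _ : Finset ι => Z) ⊤ :=
    { toFun := fun z => ⟨fun B => ∑ i ∈ B, j i (c z i), memℓp_infty (by
        obtain ⟨C, hC⟩ := (hc z).summable.exists_norm_sum_le
        exact ⟨C, by rintro _ ⟨B, rfl⟩; exact hC B⟩)⟩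
      map_add' := fun z z' => by
        ext B
        simp only [hadd, Pi.add_apply, map_add, Finset.sum_add_distrib]
        rfl
      map_smul' := fun a z => by
        ext B
        simp [hsmul, Finset.smul_sum] }
  have hS : ∀ z B, S z B = ∑ i ∈ B, j i (c z i) := fun z B => rfl
  have hScont : Continuous S := by
    refine S.continuous_of_seq_closed_graph fun u z s hu hs => ?_
    have hB : ∀ B, Tendsto (fun n => S (u n) B) atTop (𝓝 (s B)) := fun B => by
      rw [tendsto_iff_norm_sub_tendsto_zero] at hs ⊢
      refine squeeze_zero (fun _ => norm_nonneg _) (fun n => ?_) hs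
      exact lp.norm_apply_le_norm ENNReal.top_ne_zero (S (u n) - s) B
    have hx : ∀ i, ∃ x, j i x = s {i} := fun i => by
      obtain ⟨C, hC⟩ := ContinuousLinearMap.exists_antilipschitz_of_isEmbedding (hZ.isEmbedding i)
      refine (hC.isClosed_range (j i).uniformContinuous).mem_of_tendsto (hB {i})
        (Eventually.of_forall fun n => ?_)
      rw [hS, Finset.sum_singleton]
      exact mem_range_self _
    choose x hx using hx
    have hsum : ∀ B, s B = ∑ i ∈ B, j i (x i) := fun B => by
      refine tendsto_nhds_unique (hB B) ?_
      simp only [hS, hx]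
      refine tendsto_finsetSum _ fun i _ => ?_
      simpa only [hS, Finset.sum_singleton] using hB {i}
    have hxz : HasSum (fun i => j i (x i)) z := by
      refine Metric.tendsto_nhds.2 fun ε hε => ?_
      obtain ⟨n, h1, h2⟩ := ((Metric.tendsto_nhds.1 hu (ε / 3) (by positivity)).and
        (Metric.tendsto_nhds.1 hs (ε / 3) (by positivity))).exists
      have h3 : ∀ᶠ B in atTop, dist (S (u n) B) (u n) < ε / 3 :=
        Metric.tendsto_nhds.1 (hc (u n)) (ε / 3) (by positivity)
      filter_upwards [h3] with B hB3
      have h4 : dist (s B) (S (u n) B) < ε / 3 := by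
        refine lt_of_le_of_lt ?_ h2
        rw [dist_comm, dist_eq_norm, dist_eq_norm]
        exact lp.norm_apply_le_norm ENNReal.top_ne_zero (S (u n) - s) B
      rw [← hsum]
      have := dist_triangle4 (s B) (S (u n) B) (u n) z
      linarith
    ext B
    have hcx := huniq _ _ hxz
    rw [hsum, hS, ← hcx]
  let SL : Z →L[𝕜] lp (fun _ : Finset ι => Z) ⊤ := ⟨S, hScont⟩
  have hbound : ∀ (B : Finset ι) z, ‖∑ i ∈ B, j i (c z i)‖ ≤ ‖SL‖ * ‖z‖ := fun B z =>
    (lp.norm_apply_le_norm ENNReal.top_ne_zero (S z) B).trans (SL.le_opNorm z)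
  let P₀ : ∀ i, Z →ₗ[𝕜] E i := fun i =>
    { toFun := fun z => c z i
      map_add' := fun z z' => by rw [hadd]; rfl
      map_smul' := fun a z => by rw [hsmul]; rfl }
  have hP₀ : ∀ i, ∃ C, ∀ z, ‖P₀ i z‖ ≤ C * ‖z‖ := fun i => by
    obtain ⟨C, hC⟩ := ContinuousLinearMap.exists_antilipschitz_of_isEmbedding (hZ.isEmbedding i)
    refine ⟨C * ‖SL‖, fun z => ?_⟩
    have h1 := hC.le_mul_norm (map_zero _) (c z i)
    have h2 := hbound {i} z
    rw [Finset.sum_singleton] at h2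
    rw [mul_assoc]
    exact h1.trans (mul_le_mul_of_nonneg_left h2 C.2)
  choose C hC using hP₀
  exact ⟨fun i => (P₀ i).mkContinuous (C i) (hC i), hc, ‖SL‖, hbound⟩

/-! ### Daugavet spaces do not embed into unconditional sums -/

theorem mainTheorem4 {𝕜 X Z ι : Type*} {E : ι → Type*} [RCLike 𝕜]
    [NormedAddCommGroup X] [NormedSpace 𝕜 X] [CompleteSpace X] [Nontrivial X]
    [NormedAddCommGroup Z] [NormedSpace 𝕜 Z] [CompleteSpace Z]
    [∀ i, NormedAddCommGroup (E i)] [∀ i, NormedSpace 𝕜 (E i)] [∀ i, CompleteSpace (E i)]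
    (hX : IsDaugavetSpace 𝕜 X)
    (j : ∀ i, E i →L[𝕜] Z) (hZ : IsUnconditionalSum j)
    (hE : ∀ i, ¬ ContainsEllOne 𝕜 (E i)) :
    ¬ EmbedsIsomorphically 𝕜 X Z := by
  classical
  rintro ⟨J, hJ⟩
  obtain ⟨C, hC⟩ := ContinuousLinearMap.exists_antilipschitz_of_isEmbedding hJ
  obtain ⟨P, hP, K, hK⟩ := hZ.exists_projections
  let S : Finset ι → X →ₗ[𝕜] Z := fun B =>
    { toFun := fun x => ∑ i ∈ B, j i (P i (J x))
      map_add' := fun x y => by simp only [map_add, Finset.sum_add_distrib]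
      map_smul' := fun a x => by simp only [map_smul, Finset.smul_sum, RingHom.id_apply] }
  have hS : ∀ B x, S B x = ∑ i ∈ B, j i (P i (J x)) := fun B x => rfl
  have move : ∀ (A : Finset ι) (y : X), ‖y‖ ≤ 1 → ∀ (w : X) (η : ℝ), 0 < η →
      ∃ z, ‖z‖ ≤ 1 ∧ ‖w‖ + 1 / 2 ≤ ‖w + z‖ ∧ ∀ B ⊆ A, ‖S B z - S B y‖ < η := by
    intro A y hy w η hη
    set N := ∑ i ∈ A, ‖j i‖ with hN
    have hN0 : 0 ≤ N := Finset.sum_nonneg fun i _ => norm_nonneg _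
    obtain ⟨δ, hδ0, hδ1, hδ2⟩ : ∃ δ > 0, δ ≤ 1 / 2 ∧ N * δ < η := by
      refine ⟨min (1 / 2) (η / (N + 1)), lt_min (by norm_num) (by positivity), min_le_left _ _, ?_⟩
      calc N * min (1 / 2) (η / (N + 1)) ≤ N * (η / (N + 1)) :=
            mul_le_mul_of_nonneg_left (min_le_right _ _) hN0
        _ < η := by
            rw [← mul_div_assoc, div_lt_iff₀ (by positivity)]
            linarith
    obtain ⟨z, hz, hwz, hT⟩ :=
      hX.exists_generic_near hE (fun i => (P i).comp J) A hy w hδ0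
    refine ⟨z, hz, by linarith, fun B hB => lt_of_le_of_lt ?_ hδ2⟩
    rw [hS, hS, ← Finset.sum_sub_distrib, hN, Finset.sum_mul]
    refine (norm_sum_le_of_le (f := fun i => j i (P i (J z)) - j i (P i (J y))) B
      (n := fun i => ‖j i‖ * δ) fun i hi => ?_).trans
      (Finset.sum_le_sum_of_subset_of_nonneg hB fun i _ _ => by positivity)
    rw [← map_sub]
    exact (j i).le_opNorm_of_le (hT i (hB hi)).le
  have approx : ∀ (B : Finset ι) (x : X) (η : ℝ), 0 < η → ∃ A, B ⊆ A ∧ ‖S A x - J x‖ < η := by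
    intro B x η hη
    have h1 : ∀ᶠ A in atTop, dist (S A x) (J x) < η := Metric.tendsto_nhds.1 (hP (J x)) η hη
    obtain ⟨A, hA, hBA⟩ := (h1.and (eventually_ge_atTop B)).exists
    exact ⟨A, hBA, by rwa [← dist_eq_norm]⟩
  -- `v` is the sum of every other increment of a sequence of nearly `ℓ₁`-orthogonal vectors of the
  -- ball that ends in `z`, and `S B` selects from `J z` the blocks of these increments
  have key : ∀ (n : ℕ) (η : ℝ), 0 < η →
      ∃ (z : X) (B : Finset ι) (v : X), ‖z‖ ≤ 1 ∧ ‖S B z - J v‖ < η ∧ n ≤ ‖v‖ := by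
    intro n
    induction n with
    | zero => exact fun η hη => ⟨0, ∅, 0, by simp, by simpa [hS] using hη, by simp⟩
    | succ n ih =>
      intro η hη
      have hη' : 0 < η / 8 := by positivity
      obtain ⟨z, B, v, hz, hBz, hv⟩ := ih (η / 8) hη'
      obtain ⟨z₁, hz₁, hvz₁, hB₁⟩ := move B z hz (-v) (η / 8) hη'
      obtain ⟨A₁, hBA, hA₁⟩ := approx B z₁ (η / 8) hη'
      obtain ⟨z₂, hz₂, hvz₂, hB₂⟩ := move A₁ z₁ hz₁ (v - z₁) (η / 8) hη'
      obtain ⟨A₂, hA₁₂, hA₂⟩ := approx A₁ z₂ (η / 8) hη'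
      refine ⟨z₂, B ∪ A₂ \ A₁, v - z₁ + z₂, hz₂, ?_, ?_⟩
      · have hdisj : Disjoint B (A₂ \ A₁) :=
          Finset.disjoint_of_subset_left hBA Finset.disjoint_sdiff
        have h1 : S (B ∪ A₂ \ A₁) z₂ = S B z₂ + (S A₂ z₂ - S A₁ z₂) := by
          simp only [hS]
          rw [Finset.sum_union hdisj, ← Finset.sum_sdiff_eq_sub hA₁₂]
        have h2 : S (B ∪ A₂ \ A₁) z₂ - J (v - z₁ + z₂) =
            (S B z₂ - S B z₁) + (S B z₁ - S B z) + (S B z - J v) + (S A₂ z₂ - J z₂) -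
              (S A₁ z₂ - S A₁ z₁) - (S A₁ z₁ - J z₁) := by
          rw [h1, map_add, map_sub]
          abel
        rw [h2]
        -- each of the six differences is smaller than `η / 8`
        have h3 := hB₂ B hBA
        have h4 := hB₁ B subset_rfl
        have h5 := hB₂ A₁ subset_rfl
        refine ((norm_sub_le _ _).trans (add_le_add_left ((norm_sub_le _ _).trans
          (add_le_add_left ((norm_add_le _ _).trans (add_le_add_left (norm_add₃_le ..) _)) _))
          _)).trans_lt ?_
        linarith
      · rw [norm_neg, show -v + z₁ = -(v - z₁) by abel, norm_neg] at hvz₁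
        push_cast
        linarith
  obtain ⟨n, hn⟩ := exists_nat_gt (C * (max K 0 * ‖J‖ + 1))
  obtain ⟨z, B, v, hz, hBz, hv⟩ := key n 1 one_pos
  have h1 : ‖S B z‖ ≤ max K 0 * ‖J‖ := by
    refine (hK B (J z)).trans ?_
    refine mul_le_mul (le_max_left _ _) ?_ (norm_nonneg _) (le_max_right _ _)
    exact (J.le_opNorm z).trans (mul_le_of_le_one_right (norm_nonneg _) hz)
  have h2 : ‖v‖ ≤ C * ‖J v‖ := hC.le_mul_norm (map_zero J) v
  have h3 : ‖J v‖ ≤ max K 0 * ‖J‖ + 1 := by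
    have := norm_sub_norm_le (J v) (S B z)
    rw [norm_sub_rev] at this
    linarith
  have h4 := mul_le_mul_of_nonneg_left h3 C.2
  exact absurd (hn.trans_le (hv.trans (h2.trans h4))) (lt_irrefl _)
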